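/- Let $k$ be a positive integer with $k\equiv 0 \pmod 5$. Then the numbers \[ n=\frac{512k^5+1280k^4+6400k^3+8000k^2+6250k+3125}{3125}, \] \[ g_1=1,\quad g_2=\frac{32k^3+40k^2+300k+125}{125},\quad g_3=\frac{128k^4+160k^3+1200k^2-625}{625}, \] \[ g_4=\frac{128k^4+320k^3+1600k^2+1750k+1250}{625},\quad g_5=\frac{256k^4+640k^3+3000k^2+3750k+1250}{625} \] are positive integers; the residue classes of $g_1,\dots,g_5$ are five distinct non-zero elements that generate the cyclic group $\mathbb Z/n\mathbb Z$; and the undirected Cayley graph of $\mathbb Z/n\mathbb Z$ on these generators, in which two distinct vertices $u,v$ are adjacent if and only if $u-v\equiv\pm g_i \pmod n$ for some $i\in\{1,\dots,5\}$, is a graph of order $n$, regular of degree $10$, and has diameter exactly $k$. -/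

import Mathlib

/-- The five residue classes `1, g₂, g₃, g₄, g₅` modulo `n`. The undirected Cayley graph of `ZMod n`
on them is `SimpleGraph.circulantGraph (circulantGenSet n g₂ g₃ g₄ g₅)`, in which `u ≠ v` are
adjacent when `u - v` or `v - u` is one of the five. -/
def circulantGenSet (n g₂ g₃ g₄ g₅ : ℕ) : Set (ZMod n) :=
  {1, (g₂ : ZMod n), (g₃ : ZMod n), (g₄ : ZMod n), (g₅ : ZMod n)}

/-- The change of `|x|` when `k` is subtracted from `x`. -/
def absShift (k x : ℤ) : ℤ := |x - k| - |x|

lemma absShift_cases (x : ℤ) :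
    (0 < x ∧ x ≠ 0 ∧ -x ≠ x ∧ x.sign = 1 ∧ |x| = x ∧ absShift 1 x = -1 ∧ absShift (-1) x = 1 ∧
      absShift (-2) x = 2) ∨
    (x < 0 ∧ x ≠ 0 ∧ x ≠ -x ∧ x.sign = -1 ∧ |x| = -x ∧ absShift 1 x = 1 ∧ absShift (-1) x = -1 ∧
      absShift 2 x = 2) ∨ x = 0 := by
  unfold absShift
  rcases lt_trichotomy x 0 with h | h | h
  · right; left
    refine ⟨h, h.ne, by omega, Int.sign_eq_neg_one_of_neg h, abs_of_neg h, ?_⟩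
    grind
  · simp [h]
  · left
    refine ⟨h, h.ne', by omega, Int.sign_eq_one_of_pos h, abs_of_pos h, ?_⟩
    grind

lemma absShift_two_cases (x : ℤ) :
    x ≤ 0 ∨ x = 1 ∧ absShift 2 x = 0 ∨ 2 ≤ x ∧ absShift 2 x = -2 := by
  unfold absShift
  grind

lemma absShift_neg_two_cases (x : ℤ) :
    0 ≤ x ∨ x = -1 ∧ absShift (-2) x = 0 ∨ x ≤ -2 ∧ absShift (-2) x = -2 := by
  unfold absShift
  grind

lemma absShift_zero_right (k : ℤ) : absShift k 0 = |k| := by simp [absShift]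
lemma absShift_zero_left (x : ℤ) : absShift 0 x = 0 := by simp [absShift]

set_option maxHeartbeats 20000000 in
/-- No vector of norm above `5m` is minimal in its class under subtraction of one or two of the long
lattice vectors `E₁, …, E₅` while violating all of the boxes spanned by the half-sums of `±Eᵢ`; here
`hᵢ` and `hᵢⱼ` record minimality under `Eᵢ` and `Eᵢ + Eⱼ`. -/
lemma no_irreducible_point {m a b c d e : ℤ} (hm : 1 ≤ m) (ha0 : 0 ≤ a)
  (hN : 5 * m + 1 ≤ |a| + |b| + |c| + |d| + |e|)
  (h1 : a ≠ 0 → 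
    0 ≤ 4 * m - 2 * |a| + absShift a.sign b + absShift a.sign c + absShift a.sign d +
      absShift (-a.sign) e)
  (h2 : b ≠ 0 → 
    0 ≤ 4 * m + 1 - 2 * |b| + absShift (-b.sign) a + absShift b.sign d + absShift (-b.sign) e)
  (h3 : c ≠ 0 → 
    0 ≤ 4 * m - 2 * |c| + absShift (-c.sign) a + absShift c.sign d)
  (h4 : d ≠ 0 → 
    0 ≤ 4 * m + 1 - 2 * |d| + absShift (-d.sign) a + absShift (-d.sign) b + absShift (-d.sign) c)
  (h5 : e ≠ 0 → 
    0 ≤ 4 * m - 2 * |e| + absShift e.sign a + absShift e.sign b)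
  (h12 : a ≠ 0 → b ≠ 0 → 
    0 ≤ 8 * m + 1 - 2 * |a| - 2 * |b| + absShift a.sign c +
      absShift (a.sign + b.sign) d + absShift (-a.sign - b.sign) e)
  (h13 : a ≠ 0 → c ≠ 0 → 
    0 ≤ 8 * m - 2 * |a| - 2 * |c| + absShift a.sign b + absShift (a.sign + c.sign) d +
      absShift (-a.sign) e)
  (h14 : a ≠ 0 → d ≠ 0 → 
    0 ≤ 8 * m + 1 - 2 * |a| - 2 * |d| + absShift (a.sign - d.sign) b +
      absShift (a.sign - d.sign) c + absShift (-a.sign) e)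
  (h15 : a ≠ 0 → e ≠ 0 → 
    0 ≤ 8 * m - 2 * |a| - 2 * |e| + absShift (a.sign + e.sign) b + absShift a.sign c +
      absShift a.sign d)
  (h23 : b ≠ 0 → c ≠ 0 → 
    0 ≤ 8 * m + 1 - 2 * |b| - 2 * |c| + absShift (-b.sign - c.sign) a +
      absShift (b.sign + c.sign) d + absShift (-b.sign) e)
  (h24 : b ≠ 0 → d ≠ 0 → 
    0 ≤ 8 * m + 2 - 2 * |b| - 2 * |d| + absShift (-b.sign - d.sign) a +
      absShift (-d.sign) c + absShift (-b.sign) e)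
  (h25 : b ≠ 0 → e ≠ 0 → 
    0 ≤ 8 * m + 1 - 2 * |b| - 2 * |e| + absShift (-b.sign + e.sign) a + absShift b.sign d)
  (h34 : c ≠ 0 → d ≠ 0 → 
    0 ≤ 8 * m + 1 - 2 * |c| - 2 * |d| + absShift (-c.sign - d.sign) a + absShift (-d.sign) b)
  (h35 : c ≠ 0 → e ≠ 0 → 
    0 ≤ 8 * m - 2 * |c| - 2 * |e| + absShift (-c.sign + e.sign) a +
      absShift e.sign b + absShift c.sign d)
  (h45 : d ≠ 0 → e ≠ 0 → 
    0 ≤ 8 * m + 1 - 2 * |d| - 2 * |e| + absShift (-d.sign + e.sign) a +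
      absShift (-d.sign + e.sign) b + absShift (-d.sign) c)
  (hbox : ∀ s, s = 1 ∨ s = -1 → s * a = |a| → ∀ t, t = 1 ∨ t = -1 → t * b = |b| →
    ∀ u, u = 1 ∨ u = -1 → u * c = |c| → ∀ v, v = 1 ∨ v = -1 → v * d = |d| →
    ∀ w, w = 1 ∨ w = -1 → w * e = |e| →
    4 * m + s * (-t - u - v + w) < 2 * |a| ∨ 4 * m + 1 + t * (s - v + w) < 2 * |b| ∨
    4 * m + u * (s - v) < 2 * |c| ∨ 4 * m + 1 + v * (s + t + u) < 2 * |d| ∨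
    4 * m + w * (-s - t) < 2 * |e|)
  (h6 : ¬ (a = 2 * m ∧ b = -(2 * m + 1) ∧ c = 0 ∧ d = 2 * m + 1 ∧ e = 0))
  (h7 : ¬ (a = 2 * m ∧ b = 0 ∧ c = -(2 * m) ∧ d = 0 ∧ e = -(2 * m + 1))) : False := by
  have a2 := absShift_two_cases a
  have a3 := absShift_neg_two_cases a
  have b2 := absShift_two_cases b
  have b3 := absShift_neg_two_cases b
  have c2 := absShift_two_cases c
  have c3 := absShift_neg_two_cases c
  have d2 := absShift_two_cases d
  have d3 := absShift_neg_two_cases d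
  have e2 := absShift_two_cases e
  have e3 := absShift_neg_two_cases e
  rcases absShift_cases a with ha|ha|ha
  · simp [ha] at hN h1 h2 h3 h4 h5 h12 h13 h14 h15 h23 h24 h25 h34 h35 h45 hbox h6 h7
    rcases absShift_cases b with hb|hb|hb <;>
    simp [ha, hb, absShift_zero_right, absShift_zero_left] at hN h1 h2 h3 h4 h5 h12 h13 h14 h15 h23 h24 h25 h34 h35 h45 hbox h6 h7 <;>
    rcases absShift_cases c with hc|hc|hc <;>
    simp [ha, hc, absShift_zero_right, absShift_zero_left] at hN h1 h2 h3 h4 h5 h12 h13 h14 h15 h23 h24 h25 h34 h35 h45 hbox h6 h7 <;>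
    rcases absShift_cases d with hd|hd|hd <;>
    simp [ha, hb, hc, hd, absShift_zero_right, absShift_zero_left] at hN h1 h2 h3 h4 h5 h12 h13 h14 h15 h23 h24 h25 h34 h35 h45 hbox h6 h7 <;>
    rcases absShift_cases e with he|he|he <;>
    simp [ha, hb, he, absShift_zero_right, absShift_zero_left] at hN h1 h2 h3 h4 h5 h12 h13 h14 h15 h23 h24 h25 h34 h35 h45 hbox h6 h7 <;>
    omega
  · omega
  · simp [ha, absShift_zero_right, absShift_zero_left] at hN h1 h2 h3 h4 h5 h12 h13 h14 h15 h23 h24 h25 h34 h35 h45 hbox h6 h7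
    rcases absShift_cases b with hb|hb|hb <;>
    simp [hb, absShift_zero_right, absShift_zero_left] at hN h1 h2 h3 h4 h5 h12 h13 h14 h15 h23 h24 h25 h34 h35 h45 hbox h6 h7 <;>
    rcases absShift_cases c with hc|hc|hc <;>
    simp [hc, absShift_zero_right, absShift_zero_left] at hN h1 h2 h3 h4 h5 h12 h13 h14 h15 h23 h24 h25 h34 h35 h45 hbox h6 h7 <;>
    rcases absShift_cases d with hd|hd|hd <;>
    simp [hb, hc, hd, absShift_zero_right, absShift_zero_left] at hN h1 h2 h3 h4 h5 h12 h13 h14 h15 h23 h24 h25 h34 h35 h45 hbox h6 h7 <;>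
    rcases absShift_cases e with he|he|he <;>
    simp [hb, he, absShift_zero_right, absShift_zero_left] at hN h1 h2 h3 h4 h5 h12 h13 h14 h15 h23 h24 h25 h34 h35 h45 hbox h6 h7 <;>
    omega

/-- `v` lies in the lattice spanned by the rows `(4m,1,1,1,-1)`, `(-1,4m+1,0,1,-1)`, `(-1,0,4m,1,0)`,
`(-1,-1,-1,4m+1,0)`, `(1,1,0,0,4m)` and half of their sum. -/
def IsLatticeVec (m v₁ v₂ v₃ v₄ v₅ : ℤ) : Prop :=
  ∃ c₁ c₂ c₃ c₄ c₅ : ℤ,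
    2 * v₁ = 4 * m * c₁ - c₂ - c₃ - c₄ + c₅ ∧
    2 * v₂ = c₁ + (4 * m + 1) * c₂ - c₄ + c₅ ∧
    2 * v₃ = c₁ + 4 * m * c₃ - c₄ ∧
    2 * v₄ = c₁ + c₂ + c₃ + (4 * m + 1) * c₄ ∧
    2 * v₅ = -c₁ - c₂ + 4 * m * c₅

lemma absShift_sign_mul {x K : ℤ} (hx : x ≠ 0) (hK : |x| ≤ K) :
    absShift (x.sign * K) x = K - 2 * |x| := by
  unfold absShift
  rcases lt_or_gt_of_ne hx with h | h
  · rw [Int.sign_eq_neg_one_of_neg h]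
    grind
  · rw [Int.sign_eq_one_of_pos h]
    grind

lemma absShift_sign_mul_of_ge {x K : ℤ} (hx : x ≠ 0) (hK : K ≤ |x|) :
    absShift (x.sign * K) x = - K := by
  unfold absShift
  rcases lt_or_gt_of_ne hx with h | h
  · rw [Int.sign_eq_neg_one_of_neg h]
    grind
  · rw [Int.sign_eq_one_of_pos h]
    grind

lemma absShift_le (k x : ℤ) : absShift k x ≤ |k| := by
  unfold absShift
  grind

lemma abs_sign_le_one (x : ℤ) : |x.sign| ≤ 1 := by
  rcases lt_trichotomy x 0 with h | h | h
  · simp [Int.sign_eq_neg_one_of_neg h]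
  · simp [h]
  · simp [Int.sign_eq_one_of_pos h]

lemma sign_mul_sign {x y : ℤ} (hx : x ≠ 0) (hy : y ≠ 0) :
    x.sign * y.sign = 1 ∨ x.sign * y.sign = -1 := by
  rcases lt_or_gt_of_ne hx with h | h <;> rcases lt_or_gt_of_ne hy with h' | h' <;>
  simp [Int.sign_eq_neg_one_of_neg, Int.sign_eq_one_of_pos, h, h']

lemma sign_sq {x : ℤ} (hx : x ≠ 0) : x.sign ^ 2 = 1 := by
  rcases lt_or_gt_of_ne hx with h | h
  · simp [Int.sign_eq_neg_one_of_neg h]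
  · simp [Int.sign_eq_one_of_pos h]

lemma abs_sub_eq_of_le {s x v : ℤ} (hs : s = 1 ∨ s = -1) (hx : s * x = |x|) (h : |x| ≤ s * v) :
    |x - v| = s * v - |x| := by
  rcases hs with rfl | rfl
  · grind
  · grind

lemma sq_eq_one_of_sign {s : ℤ} (hs : s = 1 ∨ s = -1) : s ^ 2 = 1 := by
  rcases hs with rfl | rfl <;> norm_num

lemma exists_half_of_signs (m : ℤ) {s t u v w : ℤ} (hs : s = 1 ∨ s = -1) (ht : t = 1 ∨ t = -1)
    (hu : u = 1 ∨ u = -1) (hv : v = 1 ∨ v = -1) (hw : w = 1 ∨ w = -1) :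
    (∃ v₁, 2 * v₁ = 4 * m * s - t - u - v + w) ∧ (∃ v₂, 2 * v₂ = s + (4 * m + 1) * t - v + w) ∧
    (∃ v₃, 2 * v₃ = s + 4 * m * u - v) ∧ (∃ v₄, 2 * v₄ = s + t + u + (4 * m + 1) * v) ∧
    (∃ v₅, 2 * v₅ = -s - t + 4 * m * w) := by
  have odd {x : ℤ} (hx : x = 1 ∨ x = -1) : ∃ k, x = 2 * k + 1 := by
    rcases hx with rfl | rfl
    exacts [⟨0, rfl⟩, ⟨-1, rfl⟩]
  obtain ⟨s, rfl⟩ := odd hs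
  obtain ⟨t, rfl⟩ := odd ht
  obtain ⟨u, rfl⟩ := odd hu
  obtain ⟨v, rfl⟩ := odd hv
  obtain ⟨w, rfl⟩ := odd hw
  exact ⟨⟨2 * m * (2 * s + 1) - t - u - v + w - 1, by ring⟩,
    ⟨2 * m * (2 * t + 1) + s + t - v + w + 1, by ring⟩, ⟨2 * m * (2 * u + 1) + s - v, by ring⟩,
    ⟨2 * m * (2 * v + 1) + s + t + u + v + 2, by ring⟩,
    ⟨2 * m * (2 * w + 1) - s - t - 1, by ring⟩⟩

lemma false_of_irreducible {m a b c d e : ℤ} (hm : 1 ≤ m) (ha0 : 0 ≤ a)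
    (hmin : ∀ v₁ v₂ v₃ v₄ v₅ : ℤ, IsLatticeVec m v₁ v₂ v₃ v₄ v₅ →
      0 ≤ absShift v₁ a + absShift v₂ b + absShift v₃ c + absShift v₄ d + absShift v₅ e)
    (htie : ∀ v₁ v₂ v₃ v₄ v₅ : ℤ, IsLatticeVec m v₁ v₂ v₃ v₄ v₅ → |a - v₁| < |a| →
      0 < absShift v₁ a + absShift v₂ b + absShift v₃ c + absShift v₄ d + absShift v₅ e)
    (hfar : ∀ v₁ v₂ v₃ v₄ v₅ : ℤ, IsLatticeVec m v₁ v₂ v₃ v₄ v₅ →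
      5 * m + 1 ≤ |a - v₁| + |b - v₂| + |c - v₃| + |d - v₄| + |e - v₅|) : False := by
  have hN : 5 * m + 1 ≤ |a| + |b| + |c| + |d| + |e| := by
    simpa using hfar 0 0 0 0 0 ⟨0, 0, 0, 0, 0, by simp⟩
  have e1 : IsLatticeVec m (a.sign * (4 * m)) a.sign a.sign a.sign (-a.sign) :=
    ⟨2 * a.sign, 0, 0, 0, 0, by ring, by ring, by ring, by ring, by ring⟩
  have e2 : IsLatticeVec m (-b.sign) (b.sign * (4 * m + 1)) 0 b.sign (-b.sign) :=
    ⟨0, 2 * b.sign, 0, 0, 0, by ring, by ring, by ring, by ring, by ring⟩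
  have e3 : IsLatticeVec m (-c.sign) 0 (c.sign * (4 * m)) c.sign 0 :=
    ⟨0, 0, 2 * c.sign, 0, 0, by ring, by ring, by ring, by ring, by ring⟩
  have e4 : IsLatticeVec m (-d.sign) (-d.sign) (-d.sign) (d.sign * (4 * m + 1)) 0 :=
    ⟨0, 0, 0, 2 * d.sign, 0, by ring, by ring, by ring, by ring, by ring⟩
  have e5 : IsLatticeVec m e.sign e.sign 0 0 (e.sign * (4 * m)) :=
    ⟨0, 0, 0, 0, 2 * e.sign, by ring, by ring, by ring, by ring, by ring⟩
  have b1 : |a| ≤ 4 * m - 1 := by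
    by_contra hlt
    have hne : a ≠ 0 := by
      rintro rfl
      simp at hlt
      omega
    have hs := abs_sign_le_one a
    have hs' : |-a.sign| ≤ 1 := by rwa [abs_neg]
    have h := hmin _ _ _ _ _ e1
    have h' := htie _ _ _ _ _ e1
    rcases le_total (4 * m) |a| with h4 | h4
    · rw [absShift_sign_mul_of_ge hne h4] at h h'
      have : |a - a.sign * (4 * m)| < |a| := by
        have := absShift_sign_mul_of_ge hne h4
        unfold absShift at this
        omega
      have h' := h' this
      linarith [absShift_le a.sign b, absShift_le a.sign c, absShift_le a.sign d, absShift_le (-a.sign) e]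
    · rw [absShift_sign_mul hne h4] at h h'
      have : |a - a.sign * (4 * m)| < |a| := by
        have := absShift_sign_mul hne h4
        unfold absShift at this
        omega
      have h' := h' this
      linarith [absShift_le a.sign b, absShift_le a.sign c, absShift_le a.sign d, absShift_le (-a.sign) e]
  have b2 : |b| ≤ 4 * m := by
    by_contra hlt
    have hne : b ≠ 0 := by
      rintro rfl
      simp at hlt
      omega
    have hs := abs_sign_le_one b
    have hs' : |-b.sign| ≤ 1 := by rwa [abs_neg]
    have h := hmin _ _ _ _ _ e2
    try simp only [absShift_zero_left] at h
    rcases le_total (4 * m + 1) |b| with h4 | h4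
    · rw [absShift_sign_mul_of_ge hne h4] at h
      linarith [absShift_le (-b.sign) a, absShift_le b.sign d, absShift_le (-b.sign) e]
    · rw [absShift_sign_mul hne h4] at h
      linarith [absShift_le (-b.sign) a, absShift_le b.sign d, absShift_le (-b.sign) e]
  have b3 : |c| ≤ 4 * m - 1 := by
    by_contra hlt
    have hne : c ≠ 0 := by
      rintro rfl
      simp at hlt
      omega
    have hs := abs_sign_le_one c
    have hs' : |-c.sign| ≤ 1 := by rwa [abs_neg]
    have h := hmin _ _ _ _ _ e3
    try simp only [absShift_zero_left] at h
    rcases le_total (4 * m) |c| with h4 | h4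
    · rw [absShift_sign_mul_of_ge hne h4] at h
      linarith [absShift_le (-c.sign) a, absShift_le c.sign d]
    · rw [absShift_sign_mul hne h4] at h
      linarith [absShift_le (-c.sign) a, absShift_le c.sign d]
  have b4 : |d| ≤ 4 * m := by
    by_contra hlt
    have hne : d ≠ 0 := by
      rintro rfl
      simp at hlt
      omega
    have hs := abs_sign_le_one d
    have hs' : |-d.sign| ≤ 1 := by rwa [abs_neg]
    have h := hmin _ _ _ _ _ e4
    try simp only [absShift_zero_left] at h
    rcases le_total (4 * m + 1) |d| with h4 | h4
    · rw [absShift_sign_mul_of_ge hne h4] at h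
      linarith [absShift_le (-d.sign) a, absShift_le (-d.sign) b, absShift_le (-d.sign) c]
    · rw [absShift_sign_mul hne h4] at h
      linarith [absShift_le (-d.sign) a, absShift_le (-d.sign) b, absShift_le (-d.sign) c]
  have b5 : |e| ≤ 4 * m - 1 := by
    by_contra hlt
    have hne : e ≠ 0 := by
      rintro rfl
      simp at hlt
      omega
    have hs := abs_sign_le_one e
    have hs' : |-e.sign| ≤ 1 := by rwa [abs_neg]
    have h := hmin _ _ _ _ _ e5
    try simp only [absShift_zero_left] at h
    rcases le_total (4 * m) |e| with h4 | h4
    · rw [absShift_sign_mul_of_ge hne h4] at h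
      linarith [absShift_le e.sign a, absShift_le e.sign b]
    · rw [absShift_sign_mul hne h4] at h
      linarith [absShift_le e.sign a, absShift_le e.sign b]
  refine no_irreducible_point hm ha0 hN ?_ ?_ ?_ ?_ ?_ ?_ ?_ ?_ ?_ ?_ ?_ ?_ ?_ ?_ ?_ ?_ ?_ ?_
  · intro hne
    have h := hmin _ _ _ _ _ e1
    rw [absShift_sign_mul hne (by omega)] at h
    try simp only [absShift_zero_left] at h
    linarith
  · intro hne
    have h := hmin _ _ _ _ _ e2
    rw [absShift_sign_mul hne (by omega)] at h
    try simp only [absShift_zero_left] at h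
    linarith
  · intro hne
    have h := hmin _ _ _ _ _ e3
    rw [absShift_sign_mul hne (by omega)] at h
    try simp only [absShift_zero_left] at h
    linarith
  · intro hne
    have h := hmin _ _ _ _ _ e4
    rw [absShift_sign_mul hne (by omega)] at h
    try simp only [absShift_zero_left] at h
    linarith
  · intro hne
    have h := hmin _ _ _ _ _ e5
    rw [absShift_sign_mul hne (by omega)] at h
    try simp only [absShift_zero_left] at h
    linarith
  · intro hx hy
    have hx2 := sign_sq hx
    have hy2 := sign_sq hy
    have h := hmin (a.sign * (4 * m - (a.sign * b.sign))) (b.sign * (4 * m + 1 + (a.sign * b.sign)))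
      a.sign (a.sign + b.sign) (-a.sign - b.sign)
      ⟨2 * a.sign, 2 * b.sign, 0, 0, 0, by grind, by grind, by grind, by grind, by grind⟩
    have hxy := sign_mul_sign hx hy
    rw [absShift_sign_mul hx (by omega), absShift_sign_mul hy (by omega)] at h
    try simp only [absShift_zero_left] at h
    linarith
  · intro hx hy
    have hx2 := sign_sq hx
    have hy2 := sign_sq hy
    have h := hmin (a.sign * (4 * m - (a.sign * c.sign))) a.sign
      (c.sign * (4 * m + (a.sign * c.sign))) (a.sign + c.sign) (-a.sign)
      ⟨2 * a.sign, 0, 2 * c.sign, 0, 0, by grind, by grind, by grind, by grind, by grind⟩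
    have hxy := sign_mul_sign hx hy
    rw [absShift_sign_mul hx (by omega), absShift_sign_mul hy (by omega)] at h
    try simp only [absShift_zero_left] at h
    linarith
  · intro hx hy
    have hx2 := sign_sq hx
    have hy2 := sign_sq hy
    have h := hmin (a.sign * (4 * m - (a.sign * d.sign))) (a.sign - d.sign)
      (a.sign - d.sign) (d.sign * (4 * m + 1 + (a.sign * d.sign))) (-a.sign)
      ⟨2 * a.sign, 0, 0, 2 * d.sign, 0, by grind, by grind, by grind, by grind, by grind⟩
    have hxy := sign_mul_sign hx hy
    rw [absShift_sign_mul hx (by omega), absShift_sign_mul hy (by omega)] at h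
    try simp only [absShift_zero_left] at h
    linarith
  · intro hx hy
    have hx2 := sign_sq hx
    have hy2 := sign_sq hy
    have h := hmin (a.sign * (4 * m + (a.sign * e.sign))) (a.sign + e.sign)
      a.sign a.sign (e.sign * (4 * m - (a.sign * e.sign)))
      ⟨2 * a.sign, 0, 0, 0, 2 * e.sign, by grind, by grind, by grind, by grind, by grind⟩
    have hxy := sign_mul_sign hx hy
    rw [absShift_sign_mul hx (by omega), absShift_sign_mul hy (by omega)] at h
    try simp only [absShift_zero_left] at h
    linarith
  · intro hx hy
    have hx2 := sign_sq hx
    have hy2 := sign_sq hy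
    have h := hmin (-b.sign - c.sign) (b.sign * (4 * m + 1))
      (c.sign * (4 * m)) (b.sign + c.sign) (-b.sign)
      ⟨0, 2 * b.sign, 2 * c.sign, 0, 0, by grind, by grind, by grind, by grind, by grind⟩
    have hxy := sign_mul_sign hx hy
    rw [absShift_sign_mul hx (by omega), absShift_sign_mul hy (by omega)] at h
    try simp only [absShift_zero_left] at h
    linarith
  · intro hx hy
    have hx2 := sign_sq hx
    have hy2 := sign_sq hy
    have h := hmin (-b.sign - d.sign) (b.sign * (4 * m + 1 - (b.sign * d.sign)))
      (-d.sign) (d.sign * (4 * m + 1 + (b.sign * d.sign))) (-b.sign)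
      ⟨0, 2 * b.sign, 0, 2 * d.sign, 0, by grind, by grind, by grind, by grind, by grind⟩
    have hxy := sign_mul_sign hx hy
    rw [absShift_sign_mul hx (by omega), absShift_sign_mul hy (by omega)] at h
    try simp only [absShift_zero_left] at h
    linarith
  · intro hx hy
    have hx2 := sign_sq hx
    have hy2 := sign_sq hy
    have h := hmin (-b.sign + e.sign) (b.sign * (4 * m + 1 + (b.sign * e.sign)))
      0 b.sign (e.sign * (4 * m - (b.sign * e.sign)))
      ⟨0, 2 * b.sign, 0, 0, 2 * e.sign, by grind, by grind, by grind, by grind, by grind⟩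
    have hxy := sign_mul_sign hx hy
    rw [absShift_sign_mul hx (by omega), absShift_sign_mul hy (by omega)] at h
    try simp only [absShift_zero_left] at h
    linarith
  · intro hx hy
    have hx2 := sign_sq hx
    have hy2 := sign_sq hy
    have h := hmin (-c.sign - d.sign) (-d.sign)
      (c.sign * (4 * m - (c.sign * d.sign))) (d.sign * (4 * m + 1 + (c.sign * d.sign))) 0
      ⟨0, 0, 2 * c.sign, 2 * d.sign, 0, by grind, by grind, by grind, by grind, by grind⟩
    have hxy := sign_mul_sign hx hy
    rw [absShift_sign_mul hx (by omega), absShift_sign_mul hy (by omega)] at h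
    try simp only [absShift_zero_left] at h
    linarith
  · intro hx hy
    have hx2 := sign_sq hx
    have hy2 := sign_sq hy
    have h := hmin (-c.sign + e.sign) e.sign
      (c.sign * (4 * m)) c.sign (e.sign * (4 * m))
      ⟨0, 0, 2 * c.sign, 0, 2 * e.sign, by grind, by grind, by grind, by grind, by grind⟩
    have hxy := sign_mul_sign hx hy
    rw [absShift_sign_mul hx (by omega), absShift_sign_mul hy (by omega)] at h
    try simp only [absShift_zero_left] at h
    linarith
  · intro hx hy
    have hx2 := sign_sq hx
    have hy2 := sign_sq hy
    have h := hmin (-d.sign + e.sign) (-d.sign + e.sign)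
      (-d.sign) (d.sign * (4 * m + 1)) (e.sign * (4 * m))
      ⟨0, 0, 0, 2 * d.sign, 2 * e.sign, by grind, by grind, by grind, by grind, by grind⟩
    have hxy := sign_mul_sign hx hy
    rw [absShift_sign_mul hx (by omega), absShift_sign_mul hy (by omega)] at h
    try simp only [absShift_zero_left] at h
    linarith
  · intro s hs hsa t ht htb u hu huc v hv hvd w hw hwe
    by_contra hcon
    push Not at hcon
    obtain ⟨h1, h2, h3, h4, h5⟩ := hcon
    obtain ⟨⟨v₁, e₁⟩, ⟨v₂, e₂⟩, ⟨v₃, e₃⟩, ⟨v₄, e₄⟩, ⟨v₅, e₅⟩⟩ :=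
      exists_half_of_signs m hs ht hu hv hw
    have h := hfar v₁ v₂ v₃ v₄ v₅ ⟨s, t, u, v, w, e₁, e₂, e₃, e₄, e₅⟩
    have k₁ : 2 * (s * v₁) = 4 * m + s * (-t - u - v + w) := by
      linear_combination s * e₁ + 4 * m * sq_eq_one_of_sign hs
    have k₂ : 2 * (t * v₂) = 4 * m + 1 + t * (s - v + w) := by
      linear_combination t * e₂ + (4 * m + 1) * sq_eq_one_of_sign ht
    have k₃ : 2 * (u * v₃) = 4 * m + u * (s - v) := by
      linear_combination u * e₃ + 4 * m * sq_eq_one_of_sign hu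
    have k₄ : 2 * (v * v₄) = 4 * m + 1 + v * (s + t + u) := by
      linear_combination v * e₄ + (4 * m + 1) * sq_eq_one_of_sign hv
    have k₅ : 2 * (w * v₅) = 4 * m + w * (-s - t) := by
      linear_combination w * e₅ + 4 * m * sq_eq_one_of_sign hw
    rw [abs_sub_eq_of_le hs hsa (by linarith), abs_sub_eq_of_le ht htb (by linarith),
      abs_sub_eq_of_le hu huc (by linarith), abs_sub_eq_of_le hv hvd (by linarith),
      abs_sub_eq_of_le hw hwe (by linarith)] at h
    linarith
  · rintro ⟨rfl, rfl, rfl, rfl, rfl⟩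
    have h := hmin (2 * m) (-(2 * m)) (2 * m) (2 * m + 1) (2 * m)
      ⟨1, -1, 1, 1, 1, by ring, by ring, by ring, by ring, by ring⟩
    simp only [absShift, abs_eq_max_neg] at h
    omega
  · rintro ⟨rfl, rfl, rfl, rfl, rfl⟩
    have h := hmin (2 * m) (-(2 * m + 1)) (-(2 * m)) (2 * m) (-(2 * m))
      ⟨1, -1, -1, 1, -1, by ring, by ring, by ring, by ring, by ring⟩
    simp only [absShift, abs_eq_max_neg] at h
    omega

/-- The order of the circulant graph of diameter `5m`. -/
def circulantOrder (m : ℤ) : ℤ := 512 * m ^ 5 + 256 * m ^ 4 + 256 * m ^ 3 + 64 * m ^ 2 + 10 * m + 1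

/-- The integer combination of the five generators with coefficients `a, b, c, d, e`. -/
def genSum (m a b c d e : ℤ) : ℤ :=
  a + (32 * m ^ 3 + 8 * m ^ 2 + 12 * m + 1) * b + (128 * m ^ 4 + 32 * m ^ 3 + 48 * m ^ 2 - 1) * c +
    (128 * m ^ 4 + 64 * m ^ 3 + 64 * m ^ 2 + 14 * m + 2) * d +
    (256 * m ^ 4 + 128 * m ^ 3 + 120 * m ^ 2 + 30 * m + 2) * e

lemma genSum_neg (m a b c d e : ℤ) : genSum m (-a) (-b) (-c) (-d) (-e) = -genSum m a b c d e := by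
  unfold genSum
  ring

lemma genSum_sub (m a b c d e v₁ v₂ v₃ v₄ v₅ : ℤ) :
    genSum m (a - v₁) (b - v₂) (c - v₃) (d - v₄) (e - v₅) =
      genSum m a b c d e - genSum m v₁ v₂ v₃ v₄ v₅ := by
  unfold genSum
  ring

lemma isLatticeVec_iff_dvd {m v₁ v₂ v₃ v₄ v₅ : ℤ} :
    IsLatticeVec m v₁ v₂ v₃ v₄ v₅ ↔ circulantOrder m ∣ genSum m v₁ v₂ v₃ v₄ v₅ := by
  constructor
  · rintro ⟨c₁, c₂, c₃, c₄, c₅, h₁, h₂, h₃, h₄, h₅⟩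
    have hcop : IsCoprime (circulantOrder m) 2 :=
      ⟨1, -(256 * m ^ 5 + 128 * m ^ 4 + 128 * m ^ 3 + 32 * m ^ 2 + 5 * m), by
        unfold circulantOrder; ring⟩
    refine hcop.dvd_of_dvd_mul_left ⟨c₃ + c₄ + 2 * c₅, ?_⟩
    unfold genSum circulantOrder
    linear_combination h₁ + (32 * m ^ 3 + 8 * m ^ 2 + 12 * m + 1) * h₂ +
      (128 * m ^ 4 + 32 * m ^ 3 + 48 * m ^ 2 - 1) * h₃ +
      (128 * m ^ 4 + 64 * m ^ 3 + 64 * m ^ 2 + 14 * m + 2) * h₄ +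
      (256 * m ^ 4 + 128 * m ^ 3 + 120 * m ^ 2 + 30 * m + 2) * h₅
  · rintro ⟨w, hw⟩
    have h₁ : v₁ = circulantOrder m * w - genSum m 0 v₂ v₃ v₄ v₅ := by
      rw [← hw]; unfold genSum; ring
    subst h₁
    unfold circulantOrder genSum
    refine ⟨(256 * m ^ 4 + 128 * m ^ 3 + 64 * m ^ 2 + 8 * m + 1) * w - (16 * m ^ 2 + 4 * m + 2) * v₂ +
        (2 - 8 * m - 16 * m ^ 2 - 64 * m ^ 3) * v₃ - (1 + 16 * m + 32 * m ^ 2 + 64 * m ^ 3) * v₄ -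
        (3 + 28 * m + 64 * m ^ 2 + 128 * m ^ 3) * v₅,
      -(1 + 4 * m + 48 * m ^ 2 + 64 * m ^ 3) * w + (2 + 4 * m) * v₂ +
        (-2 + 8 * m + 16 * m ^ 2) * v₃ + (1 + 12 * m + 16 * m ^ 2) * v₄ +
        (1 + 24 * m + 32 * m ^ 2) * v₅,
      -(1 + 12 * m + 48 * m ^ 2 + 64 * m ^ 3) * w + (2 + 4 * m) * v₂ + (8 * m + 16 * m ^ 2) * v₃ +
        (3 + 12 * m + 16 * m ^ 2) * v₄ + (5 + 24 * m + 32 * m ^ 2) * v₅,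
      (1 + 4 * m + 16 * m ^ 2 - 64 * m ^ 3) * w + (-2 + 4 * m) * v₂ + (-8 * m + 16 * m ^ 2) * v₃ +
        (-1 - 4 * m + 16 * m ^ 2) * v₄ + (-3 - 8 * m + 32 * m ^ 2) * v₅,
      (1 + 4 * m + 16 * m ^ 2 + 64 * m ^ 3) * w - 4 * m * v₂ - 16 * m ^ 2 * v₃ -
        (1 + 4 * m + 16 * m ^ 2) * v₄ - (1 + 8 * m + 32 * m ^ 2) * v₅,
      by ring, by ring, by ring, by ring, by ring⟩

/-- Every residue class is the image of an integer vector of norm at most `5m`. -/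
theorem exists_short_rep {m : ℤ} (hm : 1 ≤ m) (r : ℤ) : ∃ a b c d e : ℤ,
    circulantOrder m ∣ r - genSum m a b c d e ∧ |a| + |b| + |c| + |d| + |e| ≤ 5 * m := by
  by_contra! hcon
  let S : Set (ℤ × ℤ × ℤ × ℤ × ℤ) :=
    {x | circulantOrder m ∣ r - genSum m x.1 x.2.1 x.2.2.1 x.2.2.2.1 x.2.2.2.2 ∨
      circulantOrder m ∣ -r - genSum m x.1 x.2.1 x.2.2.1 x.2.2.2.1 x.2.2.2.2}
  let f : ℤ × ℤ × ℤ × ℤ × ℤ → ℕ ×ₗ ℕ := fun x =>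
    toLex (x.1.natAbs + x.2.1.natAbs + x.2.2.1.natAbs + x.2.2.2.1.natAbs + x.2.2.2.2.natAbs,
      x.1.natAbs)
  have hne : S.Nonempty := ⟨(r, 0, 0, 0, 0), by left; simp [genSum]⟩
  obtain ⟨x, hx, hmin⟩ := (InvImage.wf f (wellFounded_lt (α := ℕ ×ₗ ℕ))).has_min S hne
  have hfarS : ∀ a b c d e : ℤ, (a, b, c, d, e) ∈ S →
      5 * m + 1 ≤ |a| + |b| + |c| + |d| + |e| := by
    rintro a b c d e (h | h)
    · exact hcon a b c d e h
    · have := hcon (-a) (-b) (-c) (-d) (-e) (by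
        rw [genSum_neg, ← dvd_neg, neg_sub', neg_neg]
        exact h)
      simp only [abs_neg] at this
      exact this
  have hneg : ∀ a b c d e : ℤ, (a, b, c, d, e) ∈ S → (-a, -b, -c, -d, -e) ∈ S := by
    rintro a b c d e (h | h)
    · right
      change _ ∣ -r - genSum m (-a) (-b) (-c) (-d) (-e)
      rw [genSum_neg, ← neg_sub', dvd_neg]
      exact h
    · left
      change _ ∣ r - genSum m (-a) (-b) (-c) (-d) (-e)
      rw [genSum_neg, ← neg_neg r, ← neg_sub', dvd_neg]
      exact h
  have hsub : ∀ a b c d e v₁ v₂ v₃ v₄ v₅ : ℤ, (a, b, c, d, e) ∈ S →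
      IsLatticeVec m v₁ v₂ v₃ v₄ v₅ → (a - v₁, b - v₂, c - v₃, d - v₄, e - v₅) ∈ S := by
    intro a b c d e v₁ v₂ v₃ v₄ v₅ h hv
    rw [isLatticeVec_iff_dvd] at hv
    simp only [S, Set.mem_ofPred_eq, genSum_sub, sub_sub_eq_add_sub, add_sub_right_comm]
    exact h.imp (fun h => dvd_add h hv) (fun h => dvd_add h hv)
  have main : ∀ a b c d e : ℤ, 0 ≤ a → (a, b, c, d, e) ∈ S →
      (∀ y ∈ S, ¬ f y < f (a, b, c, d, e)) → False := by
    intro a b c d e ha h hmin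
    refine false_of_irreducible (a := a) (b := b) (c := c) (d := d) (e := e) hm ha ?_ ?_ ?_
    · intro v₁ v₂ v₃ v₄ v₅ hv
      have := hmin _ (hsub _ _ _ _ _ _ _ _ _ _ h hv)
      simp only [f, Prod.Lex.toLex_lt_toLex] at this
      zify at this
      unfold absShift
      omega
    · intro v₁ v₂ v₃ v₄ v₅ hv hlt
      have := hmin _ (hsub _ _ _ _ _ _ _ _ _ _ h hv)
      simp only [f, Prod.Lex.toLex_lt_toLex] at this
      zify at this
      unfold absShift
      omega
    · intro v₁ v₂ v₃ v₄ v₅ hv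
      exact hfarS _ _ _ _ _ (hsub _ _ _ _ _ _ _ _ _ _ h hv)
  obtain ⟨a, b, c, d, e⟩ := x
  rcases le_total 0 a with ha | ha
  · exact main a b c d e ha hx hmin
  · refine main (-a) (-b) (-c) (-d) (-e) (by omega) (hneg _ _ _ _ _ hx) ?_
    intro y hy hlt
    refine hmin y hy ?_
    simpa only [InvImage, f, Int.natAbs_neg] using hlt

/-- Lattice vectors of odd coordinate sum have norm at least `10m+1`. -/
theorem norm_ge_of_odd {m v₁ v₂ v₃ v₄ v₅ : ℤ} (hm : 1 ≤ m) (hv : IsLatticeVec m v₁ v₂ v₃ v₄ v₅)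
    (hodd : Odd (v₁ + v₂ + v₃ + v₄ + v₅)) : 10 * m + 1 ≤ |v₁| + |v₂| + |v₃| + |v₄| + |v₅| := by
  obtain ⟨c₁, c₂, c₃, c₄, c₅, h₁, h₂, h₃, h₄, h₅⟩ := hv
  have key : ∀ c : ℤ, ∃ p : ℤ, 4 * m * c = 4 * p ∧ (4 * m + 1) * c = 4 * p + c ∧
      (2 ∣ c → 2 ∣ p) ∧ (1 ≤ c → m + c - 1 ≤ p) ∧ (c ≤ -1 → p ≤ -m + c + 1) := fun c =>
    ⟨m * c, by ring, by ring, fun hc => hc.mul_left m, fun hc => by nlinarith, fun hc => by nlinarith⟩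
  obtain ⟨p₁, q₁, -, t₁, r₁, s₁⟩ := key c₁
  obtain ⟨p₂, -, q₂, t₂, r₂, s₂⟩ := key c₂
  obtain ⟨p₃, q₃, -, t₃, r₃, s₃⟩ := key c₃
  obtain ⟨p₄, -, q₄, t₄, r₄, s₄⟩ := key c₄
  obtain ⟨p₅, q₅, -, t₅, r₅, s₅⟩ := key c₅
  rw [q₁] at h₁
  rw [q₂] at h₂
  rw [q₃] at h₃
  rw [q₄] at h₄
  rw [q₅] at h₅
  obtain ⟨k, hk⟩ := hodd
  have hpar : (2 ∣ c₁ ↔ 2 ∣ c₄) ∧ (2 ∣ c₁ ↔ 2 ∣ c₂) ∧ (2 ∣ c₁ ↔ 2 ∣ c₅) ∧ (2 ∣ c₁ ↔ 2 ∣ c₃) := by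
    clear r₁ r₂ r₃ r₄ r₅ s₁ s₂ s₃ s₄ s₅ t₁ t₂ t₃ t₄ t₅ q₁ q₂ q₃ q₄ q₅ hk
    omega
  obtain ⟨y₄, y₂, y₅, y₃⟩ := hpar
  have y₁ : ¬ 2 ∣ c₁ := by
    intro y
    obtain ⟨z₁, rfl⟩ := t₁ y
    obtain ⟨z₂, rfl⟩ := t₂ (y₂.mp y)
    obtain ⟨z₃, rfl⟩ := t₃ (y₃.mp y)
    obtain ⟨z₄, rfl⟩ := t₄ (y₄.mp y)
    obtain ⟨z₅, rfl⟩ := t₅ (y₅.mp y)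
    clear r₁ r₂ r₃ r₄ r₅ s₁ s₂ s₃ s₄ s₅ t₁ t₂ t₃ t₄ t₅ q₁ q₂ q₃ q₄ q₅
    omega
  have dich : ∀ c : ℤ, ¬ 2 ∣ c → c ≤ -1 ∨ 1 ≤ c := by intros; omega
  have l₁ := abs_le.mp (le_refl |v₁|)
  have l₂ := abs_le.mp (le_refl |v₂|)
  have l₃ := abs_le.mp (le_refl |v₃|)
  have l₄ := abs_le.mp (le_refl |v₄|)
  have l₅ := abs_le.mp (le_refl |v₅|)
  rcases dich c₁ y₁ with i₁ | i₁ <;>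
  (first | replace s₁ := s₁ i₁ | replace s₁ := r₁ i₁) <;>
  rcases dich c₂ (y₂.not.mp y₁) with i₂ | i₂ <;>
  (first | replace s₂ := s₂ i₂ | replace s₂ := r₂ i₂) <;>
  rcases dich c₃ (y₃.not.mp y₁) with i₃ | i₃ <;>
  (first | replace s₃ := s₃ i₃ | replace s₃ := r₃ i₃) <;>
  rcases dich c₄ (y₄.not.mp y₁) with i₄ | i₄ <;>
  (first | replace s₄ := s₄ i₄ | replace s₄ := r₄ i₄) <;>
  rcases dich c₅ (y₅.not.mp y₁) with i₅ | i₅ <;>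
  (first | replace s₅ := s₅ i₅ | replace s₅ := r₅ i₅) <;>
  linarith only [h₁, h₂, h₃, h₄, h₅, l₁, l₂, l₃, l₄, l₅, i₁, i₂, i₃, i₄, i₅, s₁, s₂, s₃, s₄, s₅]

namespace SimpleGraph

lemma circulantGraph_edist_add_nsmul_le {A : Type*} [AddCommGroup A] {S : Set A} {g : A}
    (hg : g ∈ S) (u : A) (j : ℕ) : (circulantGraph S).edist u (u + j • g) ≤ j := by
  induction j with
  | zero => simp
  | succ j ih =>
    refine ((circulantGraph S).edist_triangle (v := u + j • g)).trans ?_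
    push_cast
    refine add_le_add ih ?_
    rw [edist_le_one_iff_adj_or_eq]
    by_cases h : u + j • g = u + (j + 1) • g
    · exact Or.inr h
    · left
      rw [circulantGraph_adj]
      exact ⟨h, Or.inr (by simpa [succ_nsmul, ← add_assoc] using hg)⟩

lemma circulantGraph_edist_add_zsmul_le {A : Type*} [AddCommGroup A] {S : Set A} {g : A}
    (hg : g ∈ S) (u : A) (j : ℤ) : (circulantGraph S).edist u (u + j • g) ≤ j.natAbs := by
  rcases Int.natAbs_eq j with h | h
  · have := circulantGraph_edist_add_nsmul_le hg u j.natAbs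
    rwa [← natCast_zsmul, ← h] at this
  · have := circulantGraph_edist_add_nsmul_le hg (u + j • g) j.natAbs
    rwa [← natCast_zsmul, add_assoc, ← add_smul, show j + (j.natAbs : ℤ) = 0 by omega, zero_smul,
      add_zero, edist_comm] at this

lemma circulantGraph_edist_add_zsmul_le_add {A : Type*} [AddCommGroup A] {S : Set A} {g u w : A}
    {K : ℕ∞} (h : (circulantGraph S).edist u w ≤ K) (hg : g ∈ S) (j : ℤ) :
    (circulantGraph S).edist u (w + j • g) ≤ K + j.natAbs :=
  SimpleGraph.edist_triangle.trans (add_le_add h (circulantGraph_edist_add_zsmul_le hg w j))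

end SimpleGraph

open SimpleGraph in
lemma edist_le_of_sub_eq {n g₂ g₃ g₄ g₅ : ℕ} {u v : ZMod n} {a b c d e : ℤ}
    (h : v - u = ((a + g₂ * b + g₃ * c + g₄ * d + g₅ * e : ℤ) : ZMod n)) :
    (circulantGraph (circulantGenSet n g₂ g₃ g₄ g₅)).edist u v ≤
      (a.natAbs + b.natAbs + c.natAbs + d.natAbs + e.natAbs : ℕ) := by
  obtain rfl : v = u + a • 1 + b • (g₂ : ZMod n) + c • (g₃ : ZMod n) + d • (g₄ : ZMod n) +
      e • (g₅ : ZMod n) := by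
    rw [sub_eq_iff_eq_add] at h
    rw [h]
    simp only [zsmul_eq_mul]
    push_cast
    ring
  push_cast
  refine circulantGraph_edist_add_zsmul_le_add (circulantGraph_edist_add_zsmul_le_add
    (circulantGraph_edist_add_zsmul_le_add (circulantGraph_edist_add_zsmul_le_add
    (circulantGraph_edist_add_zsmul_le ?_ _ _) ?_ _) ?_ _) ?_ _) ?_ _
  all_goals simp [circulantGenSet]

open SimpleGraph in
lemma exists_sub_eq_of_walk {n g₂ g₃ g₄ g₅ : ℕ} {u v : ZMod n}
    (p : (circulantGraph (circulantGenSet n g₂ g₃ g₄ g₅)).Walk u v) :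
    ∃ a b c d e : ℤ, v - u = ((a + g₂ * b + g₃ * c + g₄ * d + g₅ * e : ℤ) : ZMod n) ∧
      a.natAbs + b.natAbs + c.natAbs + d.natAbs + e.natAbs ≤ p.length := by
  induction p with
  | nil => exact ⟨0, 0, 0, 0, 0, by simp, by simp⟩
  | @cons u w v hadj p ih =>
    obtain ⟨a, b, c, d, e, h, hle⟩ := ih
    have step : ∀ s : ℤ, s.natAbs = 1 → ∀ x ∈ circulantGenSet n g₂ g₃ g₄ g₅, w - u = s * x →
        ∃ a b c d e : ℤ, v - u = ((a + g₂ * b + g₃ * c + g₄ * d + g₅ * e : ℤ) : ZMod n) ∧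
        a.natAbs + b.natAbs + c.natAbs + d.natAbs + e.natAbs ≤ p.length + 1 := by
      intro s hs x hx hw
      have hv : v - u = (v - w) + s * x := by rw [← hw]; ring
      rw [hv, h]
      rcases hx with rfl | rfl | rfl | rfl | rfl
      · exact ⟨a + s, b, c, d, e, by push_cast; ring, by omega⟩
      · exact ⟨a, b + s, c, d, e, by push_cast; ring, by omega⟩
      · exact ⟨a, b, c + s, d, e, by push_cast; ring, by omega⟩
      · exact ⟨a, b, c, d + s, e, by push_cast; ring, by omega⟩
      · exact ⟨a, b, c, d, e + s, by push_cast; ring, by omega⟩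
    rw [circulantGraph_adj] at hadj
    rcases hadj.2 with hx | hx
    · exact step (-1) rfl _ hx (by push_cast; ring)
    · exact step 1 rfl _ hx (by push_cast; ring)

lemma ZMod.ncard_image_add_natCast {n : ℕ} (v : ZMod n) {T : Finset ℕ} (hT : ∀ x ∈ T, x < n) :
    ((fun x : ℕ => v + (x : ZMod n)) '' (T : Set ℕ)).ncard = T.card := by
  rw [Set.InjOn.ncard_image, Set.ncard_coe_finset]
  intro x hx y hy hxy
  have := (ZMod.natCast_eq_natCast_iff' x y n).mp (add_left_cancel hxy)
  rwa [Nat.mod_eq_of_lt (hT x hx), Nat.mod_eq_of_lt (hT y hy)] at this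

section CayleyData

variable {n g₂ g₃ g₄ g₅ : ℕ}

lemma circulantGenSet_eq_image : circulantGenSet n g₂ g₃ g₄ g₅ =
    (fun x : ℕ => (0 : ZMod n) + x) '' (({1, g₂, g₃, g₄, g₅} : Finset ℕ) : Set ℕ) := by
  simp [circulantGenSet, Set.image_insert_eq]

lemma ncard_circulantGenSet (h₂ : 1 < g₂) (h₃ : g₂ < g₃) (h₄ : g₃ < g₄) (h₅ : g₄ < g₅)
    (hn : g₅ < n) : (circulantGenSet n g₂ g₃ g₄ g₅).ncard = 5 := by
  rw [circulantGenSet_eq_image, ZMod.ncard_image_add_natCast]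
  · repeat rw [Finset.card_insert_of_notMem (by simp; omega)]
    simp
  · simp
    omega

lemma circulantGenSet_subset (h₂ : 1 < g₂) (h₃ : g₂ < g₃) (h₄ : g₃ < g₄) (h₅ : g₄ < g₅)
    (hn : g₅ < n) : circulantGenSet n g₂ g₃ g₄ g₅ ⊆ {0}ᶜ := by
  rw [circulantGenSet_eq_image]
  rintro _ ⟨x, hx, rfl⟩ h0
  simp only [zero_add, Set.mem_singleton_iff, ZMod.natCast_eq_zero_iff] at h0
  have hx : 0 < x ∧ x < n := by
    simp at hx
    omega
  exact (Nat.le_of_dvd hx.1 h0).not_gt hx.2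

lemma closure_circulantGenSet : AddSubgroup.closure (circulantGenSet n g₂ g₃ g₄ g₅) = ⊤ := by
  rw [eq_top_iff]
  intro x _
  have h1 : (1 : ZMod n) ∈ AddSubgroup.closure (circulantGenSet n g₂ g₃ g₄ g₅) :=
    AddSubgroup.subset_closure (by simp [circulantGenSet])
  obtain ⟨z, rfl⟩ := ZMod.intCast_surjective x
  simpa using AddSubgroup.zsmul_mem _ h1 z

lemma ncard_neighborSet_circulantGenSet (h₂ : 1 < g₂) (h₃ : g₂ < g₃) (h₄ : g₃ < g₄) (h₅ : g₄ < g₅)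
    (hn : 2 * g₅ < n) (v : ZMod n) : ((SimpleGraph.circulantGraph
      (circulantGenSet n g₂ g₃ g₄ g₅)).neighborSet v).ncard = 10 := by
  have hS := circulantGenSet_subset h₂ h₃ h₄ h₅ (by omega : g₅ < n)
  have key : (SimpleGraph.circulantGraph (circulantGenSet n g₂ g₃ g₄ g₅)).neighborSet v =
      (fun x : ℕ => v + (x : ZMod n)) '' (({n - 1, n - g₂, n - g₃, n - g₄, n - g₅, 1, g₂, g₃, g₄,
        g₅} : Finset ℕ) : Set ℕ) := by
    ext w
    have hw : (v ≠ w ∧ (v - w ∈ circulantGenSet n g₂ g₃ g₄ g₅ ∨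
        w - v ∈ circulantGenSet n g₂ g₃ g₄ g₅)) ↔ (v - w ∈ circulantGenSet n g₂ g₃ g₄ g₅ ∨
        w - v ∈ circulantGenSet n g₂ g₃ g₄ g₅) := by
      refine and_iff_right_of_imp ?_
      rintro h rfl
      simp only [sub_self, or_self] at h
      exact hS h rfl
    rw [SimpleGraph.mem_neighborSet, SimpleGraph.circulantGraph_adj, hw]
    have e : ∀ g : ℕ, g ≤ n → (w = v + ((n - g : ℕ) : ZMod n) ↔ v - w = g) := by
      intro g hg
      rw [Nat.cast_sub hg, ZMod.natCast_self, zero_sub]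
      constructor
      · rintro rfl
        ring
      · intro h
        rw [← h]
        ring
    have e' : ∀ g : ℕ, w = v + (g : ZMod n) ↔ w - v = g := fun g => by
      rw [sub_eq_iff_eq_add']
    have e₁ := e' 1
    have f₁ := e 1 (by omega)
    rw [Nat.cast_one] at e₁ f₁
    simp only [Finset.coe_insert, Finset.coe_singleton, Set.image_insert_eq, Set.image_singleton,
      Set.mem_insert_iff, Set.mem_singleton_iff, e₁, e' g₂, e' g₃, e' g₄, e' g₅, e g₂ (by omega), e g₃ (by omega),
      e g₄ (by omega), e g₅ (by omega), f₁, Nat.cast_one, circulantGenSet, or_assoc]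
  rw [key, ZMod.ncard_image_add_natCast]
  · repeat rw [Finset.card_insert_of_notMem (by simp; omega)]
    simp
  · simp
    omega

end CayleyData

open SimpleGraph in
lemma ediam_circulantGenSet {m n g₂ g₃ g₄ g₅ : ℕ} (hm : 1 ≤ m)
    (hn : (n : ℤ) = circulantOrder m)
    (hg : ∀ a b c d e : ℤ, a + g₂ * b + g₃ * c + g₄ * d + g₅ * e = genSum m a b c d e) :
    (circulantGraph (circulantGenSet n g₂ g₃ g₄ g₅)).ediam = ((5 * m : ℕ) : ℕ∞) := by
  have hm' : (1 : ℤ) ≤ m := by exact_mod_cast hm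
  apply le_antisymm
  · refine ediam_le_of_edist_le fun u v => ?_
    obtain ⟨r, hr⟩ := ZMod.intCast_surjective (v - u)
    obtain ⟨a, b, c, d, e, hdvd, hle⟩ := exists_short_rep hm' r
    refine (edist_le_of_sub_eq (a := a) (b := b) (c := c) (d := d) (e := e) ?_).trans ?_
    · rw [← hr, hg, eq_comm, ZMod.intCast_eq_intCast_iff_dvd_sub, hn]
      exact hdvd
    · rw [Nat.cast_le]
      zify
      exact hle
  · refine le_trans ?_ (edist_le_ediam (u := 0) (v := ((genSum m m m m m m : ℤ) : ZMod n)))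
    by_contra! hlt
    obtain ⟨p, hp⟩ := exists_walk_of_edist_ne_top hlt.ne_top
    rw [← hp, Nat.cast_lt] at hlt
    obtain ⟨a, b, c, d, e, h, hle⟩ := exists_sub_eq_of_walk p
    rw [sub_zero, hg, eq_comm, ZMod.intCast_eq_intCast_iff_dvd_sub, hn, ← genSum_sub,
      ← isLatticeVec_iff_dvd] at h
    have hlt' : |a| + |b| + |c| + |d| + |e| < 5 * m := by
      have := hle.trans_lt hlt
      zify at this
      exact this
    have tri : ∀ x y : ℤ, 0 ≤ y → |y - x| ≤ y + |x| := fun x y hy => by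
      simpa [abs_of_nonneg hy] using abs_sub y x
    rcases Int.even_or_odd ((m - a) + (m - b) + (m - c) + (m - d) + (m - e)) with hev | hodd
    · obtain ⟨c₁, c₂, c₃, c₄, c₅, h₁, h₂, h₃, h₄, h₅⟩ := h
      have h' : IsLatticeVec m (m - 1 + a) (m + 1 + b) (m + c) (m + 2 + d) (m - 1 + e) :=
        ⟨1 - c₁, 1 - c₂, 1 - c₃, 1 - c₄, 1 - c₅, by linear_combination -h₁,
          by linear_combination -h₂, by linear_combination -h₃, by linear_combination -h₄,
          by linear_combination -h₅⟩
      have hodd : Odd ((m - 1 + a) + (m + 1 + b) + (m + c) + (m + 2 + d) + (m - 1 + e) : ℤ) := by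
        obtain ⟨t, ht⟩ := hev
        exact ⟨5 * m - t, by linarith⟩
      have := norm_ge_of_odd hm' h' hodd
      have t₁ := tri (-a) (m - 1) (by omega)
      have t₂ := tri (-b) (m + 1) (by omega)
      have t₃ := tri (-c) m (by omega)
      have t₄ := tri (-d) (m + 2) (by omega)
      have t₅ := tri (-e) (m - 1) (by omega)
      rw [sub_neg_eq_add, abs_neg] at t₁ t₂ t₃ t₄ t₅
      linarith
    · have := norm_ge_of_odd hm' h hodd
      linarith [tri a m (by omega), tri b m (by omega), tri c m (by omega), tri d m (by omega),
        tri e m (by omega)]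

theorem theorem3 (k : ℕ) (hk : 0 < k) (hk5 : k ≡ 0 [MOD 5]) :
    ∃ n g₂ g₃ g₄ g₅ : ℕ,
      (n : ℚ) = (512 * (k : ℚ) ^ 5 + 1280 * (k : ℚ) ^ 4 + 6400 * (k : ℚ) ^ 3
        + 8000 * (k : ℚ) ^ 2 + 6250 * (k : ℚ) + 3125) / 3125 ∧
      (g₂ : ℚ) = (32 * (k : ℚ) ^ 3 + 40 * (k : ℚ) ^ 2 + 300 * (k : ℚ) + 125) / 125 ∧
      (g₃ : ℚ) = (128 * (k : ℚ) ^ 4 + 160 * (k : ℚ) ^ 3 + 1200 * (k : ℚ) ^ 2 - 625) / 625 ∧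
      (g₄ : ℚ) = (128 * (k : ℚ) ^ 4 + 320 * (k : ℚ) ^ 3 + 1600 * (k : ℚ) ^ 2
        + 1750 * (k : ℚ) + 1250) / 625 ∧
      (g₅ : ℚ) = (256 * (k : ℚ) ^ 4 + 640 * (k : ℚ) ^ 3 + 3000 * (k : ℚ) ^ 2
        + 3750 * (k : ℚ) + 1250) / 625 ∧
      circulantGenSet n g₂ g₃ g₄ g₅ ⊆ {0}ᶜ ∧
      (circulantGenSet n g₂ g₃ g₄ g₅).ncard = 5 ∧
      AddSubgroup.closure (circulantGenSet n g₂ g₃ g₄ g₅) = ⊤ ∧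
      (∀ v : ZMod n, ((SimpleGraph.circulantGraph
        (circulantGenSet n g₂ g₃ g₄ g₅)).neighborSet v).ncard = 10) ∧
      (SimpleGraph.circulantGraph (circulantGenSet n g₂ g₃ g₄ g₅)).ediam = (k : ℕ∞) := by
  obtain ⟨m, rfl⟩ : 5 ∣ k := (Nat.modEq_zero_iff_dvd).mp hk5
  have hm : 1 ≤ m := by omega
  obtain ⟨j, hj⟩ : ∃ j, m = j + 1 := ⟨m - 1, by omega⟩
  obtain ⟨n, hn⟩ : ∃ n, n = 512 * m ^ 5 + 256 * m ^ 4 + 256 * m ^ 3 + 64 * m ^ 2 + 10 * m + 1 :=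
    ⟨_, rfl⟩
  obtain ⟨g₂, hg₂⟩ : ∃ g, g = 32 * m ^ 3 + 8 * m ^ 2 + 12 * m + 1 := ⟨_, rfl⟩
  obtain ⟨g₃, hg₃⟩ : ∃ g, g + 1 = 128 * m ^ 4 + 32 * m ^ 3 + 48 * m ^ 2 :=
    Nat.exists_add_one_eq.mpr (by positivity)
  obtain ⟨g₄, hg₄⟩ : ∃ g, g = 128 * m ^ 4 + 64 * m ^ 3 + 64 * m ^ 2 + 14 * m + 2 := ⟨_, rfl⟩
  obtain ⟨g₅, hg₅⟩ : ∃ g, g = 256 * m ^ 4 + 128 * m ^ 3 + 120 * m ^ 2 + 30 * m + 2 := ⟨_, rfl⟩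
  have b₂ : 1 < g₂ := by subst hg₂; nlinarith
  have b₃ : g₂ < g₃ := by
    have p₂ := Nat.zero_le (j ^ 2)
    have p₃ := Nat.zero_le (j ^ 3)
    have p₄ := Nat.zero_le (j ^ 4)
    subst hj
    nlinarith
  have b₄ : g₃ < g₄ := by
    have p₂ := Nat.zero_le (m ^ 2)
    have p₃ := Nat.zero_le (m ^ 3)
    linarith
  have b₅ : g₄ < g₅ := by
    have p₂ := Nat.zero_le (m ^ 2)
    have p₃ := Nat.zero_le (m ^ 3)
    have p₄ := Nat.zero_le (m ^ 4)
    linarith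
  have bn : 2 * g₅ < n := by
    have p₂ := Nat.zero_le (j ^ 2)
    have p₃ := Nat.zero_le (j ^ 3)
    have p₄ := Nat.zero_le (j ^ 4)
    have p₅ := Nat.zero_le (j ^ 5)
    subst hj
    nlinarith
  refine ⟨n, g₂, g₃, g₄, g₅, ?_, ?_, ?_, ?_, ?_, circulantGenSet_subset b₂ b₃ b₄ b₅ (by omega),
    ncard_circulantGenSet b₂ b₃ b₄ b₅ (by omega), closure_circulantGenSet,
    ncard_neighborSet_circulantGenSet b₂ b₃ b₄ b₅ bn, ediam_circulantGenSet hm ?_ ?_⟩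
  · rw [hn]
    push_cast
    ring
  · rw [hg₂]
    push_cast
    ring
  · have : (g₃ : ℚ) + 1 = 128 * m ^ 4 + 32 * m ^ 3 + 48 * m ^ 2 := by exact_mod_cast hg₃
    push_cast
    linear_combination this
  · rw [hg₄]
    push_cast
    ring
  · rw [hg₅]
    push_cast
    ring
  · rw [hn]
    push_cast [circulantOrder]
    ring
  · intro a b c d e
    have : (g₃ : ℤ) = 128 * m ^ 4 + 32 * m ^ 3 + 48 * m ^ 2 - 1 := by
      rw [eq_sub_iff_add_eq]
      exact_mod_cast hg₃
    rw [this, hg₂, hg₄, hg₅]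
    unfold genSum
    push_cast
    ring
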